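/- Let $n\ge 1$ be an integer. For $i=1,2$ let $p_i:\mathbb R\to\mathbb R$ be continuous and $2\pi$-periodic, and put $$\widehat p_{i,n}=\int_0^{2\pi}p_i(t)\,e^{int}\,dt .$$ Let $\phi_1,\phi_2:\mathbb R\to\mathbb R$ be locally Lipschitz continuous and bounded, such that for $i=1,2$ the finite limits $\phi_i(\pm\infty)=\lim_{s\to\pm\infty}\phi_i(s)$ exist and $\phi_i(-\infty)=-\phi_i(+\infty)$. Consider the system $$\ddot x_1+a_1x_1^+-b_1x_1^-+\phi_1(x_2)=p_1(t),\qquad \ddot x_2+a_2x_2^+-b_2x_2^-+\phi_2(x_1)=p_2(t),$$ where $x^\pm=\max\{\pm x,0\}$, in the symmetric linear case $a_1=b_1=a_2=b_2=n^2$ (that is, $\ddot x_1+n^2x_1+\phi_1(x_2)=p_1(t)$ and $\ddot x_2+n^2x_2+\phi_2(x_1)=p_2(t)$). Assume that $$\widehat p_{1,n}=0,\qquad \phi_1(+\infty)\neq 0,\qquad |\phi_2(+\infty)|<\frac{3}{16}\,|\widehat p_{2,n}| .$$ Then there exist two (Lebesgue measurable) sets $E^+,E^-\subset\mathbb R^2\times\mathbb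 R^2$ of infinite Lebesgue measure such that: * for every solution $x=(x_1,x_2)$ of the system with $(x(0),\dot x(0))\in E^+$, $$\lim_{t\to+\infty}\bigl(|x_i(t)|^2+|\dot x_i(t)|^2\bigr)=+\infty,\qquad i=1,2;$$ * for every solution $x=(x_1,x_2)$ of the system with $(x(0),\dot x(0))\in E^-$, $$\lim_{t\to-\infty}\bigl(|x_i(t)|^2+|\dot x_i(t)|^2\bigr)=+\infty,\qquad i=1,2.$$ -/

import Mathlib

open Real Filter Topology MeasureTheory

noncomputable section

/-- `x = (x₀, x₁)` is a (classical, twice differentiable, defined on the whole real line) solution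
of the system of coupled asymmetric oscillators
`xᵢ'' + aᵢ xᵢ⁺ - bᵢ xᵢ⁻ + φᵢ(xᵢ₊₁) = pᵢ(t)`, `i ∈ {0, 1}`,
where `x⁺ = max {x, 0}`, `x⁻ = max {-x, 0}` and the index `i + 1` is taken modulo 2. -/
structure IsOscillatorSolution (a b : Fin 2 → ℝ) (φ p x : Fin 2 → ℝ → ℝ) : Prop where
  differentiable : ∀ i, Differentiable ℝ (x i)
  differentiable_deriv : ∀ i, Differentiable ℝ (deriv (x i))
  equation : ∀ i t,
    deriv (deriv (x i)) t + a i * (x i t)⁺ - b i * (x i t)⁻ + φ i (x (i + 1) t) = p i t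

/-- The initial datum `(x(0), x'(0)) ∈ ℝ² × ℝ²` of `x = (x₀, x₁)`. -/
def initialDatum (x : Fin 2 → ℝ → ℝ) : (Fin 2 → ℝ) × (Fin 2 → ℝ) :=
  (fun i => x i 0, fun i => deriv (x i) 0)

/-- The `n`-th Fourier coefficient `∫₀^{2π} p(t) e^{int} dt`, without normalizing factor. -/
def pHat (p : ℝ → ℝ) (n : ℕ) : ℂ :=
  ∫ t in (0 : ℝ)..(2 * π), (p t : ℂ) * Complex.exp (Complex.I * (n : ℂ) * (t : ℂ))

end

/-! Write `u`, `v` for the phasors of the two components. The factor `e^{-int}` removes the free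
rotation, so over one period a phasor moves by the integral of `e^{-int}` against forcing minus
coupling. If the other phasor `w` is large, the coupling term is nearly `L` times a square wave in
phase with `w`, whose Fourier coefficient gives the displacement `conj (pHat p n) + 4iL w/‖w‖` up to
a small error (`exists_norm_phasor_two_pi_sub_le`).

With `P = conj (pHat (p 1) n)`, each step of `v` is therefore `P` plus a vector shorter than
`(3/4)‖P‖`, up to error. Such steps lie in a fixed convex cone about `P`, so `v` stays in that cone
and escapes. Since `pHat (p 0) n = 0`, the step of `u` is about `4iL₀ v/‖v‖`; as `v` stays in the
cone, these steps have a component bounded below along a fixed direction, and `u` escapes too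
(`exists_wedge_step`). The wedge of such data contains arbitrarily large balls, hence has infinite
measure. Time reversal gives the past. -/

open ComplexConjugate

/-! ### Phasors and variation of constants -/

/-- The phasor `x' + i n x` of a function `x`. -/
noncomputable def phasor (n : ℕ) (x : ℝ → ℝ) (t : ℝ) : ℂ := ⟨deriv x t, n * x t⟩

/-- The rotation `e^{-int}`. -/
noncomputable def rotor (n : ℕ) (t : ℝ) : ℂ := Complex.exp (-(Complex.I * (n : ℂ) * (t : ℂ)))

theorem continuous_rotor (n : ℕ) : Continuous (rotor n) := by
  unfold rotor; fun_prop

theorem norm_rotor (n : ℕ) (t : ℝ) : ‖rotor n t‖ = 1 := by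
  unfold rotor
  rw [show -(Complex.I * (n : ℂ) * (t : ℂ)) = ((-(n * t) : ℝ) : ℂ) * Complex.I by push_cast; ring]
  exact Complex.norm_exp_ofReal_mul_I _

theorem rotor_two_pi (n : ℕ) : rotor n (2 * π) = 1 := by
  unfold rotor
  rw [Complex.exp_neg,
    show Complex.I * (n : ℂ) * ((2 * π : ℝ) : ℂ) = (n : ℕ) * (2 * π * Complex.I) by push_cast; ring,
    Complex.exp_nat_mul_two_pi_mul_I, inv_one]

theorem rotor_zero (n : ℕ) : rotor n 0 = 1 := by simp [rotor]

theorem rotor_ne_zero (n : ℕ) (t : ℝ) : rotor n t ≠ 0 := Complex.exp_ne_zero _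

/-- The rotor is an integrating factor: the rotated phasor has derivative `rotor * (x'' + n²x)`. -/
theorem rotor_mul_phasor_sub (n : ℕ) (x f : ℝ → ℝ) (hx : Differentiable ℝ x)
    (hx' : Differentiable ℝ (deriv x)) (hf : Continuous f)
    (heq : ∀ t, deriv (deriv x) t + (n : ℝ) ^ 2 * x t = f t) (t : ℝ) :
    rotor n t * phasor n x t - phasor n x 0 = ∫ s in (0 : ℝ)..t, rotor n s * (f s : ℂ) := by
  have key : ∀ s, HasDerivAt (fun s => rotor n s * phasor n x s) (rotor n s * (f s : ℂ)) s := by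
    intro s
    have h1 : HasDerivAt (fun s => ((deriv x s : ℝ) : ℂ) + ((n * x s : ℝ) : ℂ) * Complex.I)
        (((deriv (deriv x) s : ℝ) : ℂ) + ((n * deriv x s : ℝ) : ℂ) * Complex.I) s :=
      (hx' s).hasDerivAt.ofReal_comp.add
        (((hx s).hasDerivAt.const_mul (n : ℝ)).ofReal_comp.mul_const Complex.I)
    have h2 : HasDerivAt (rotor n) (rotor n s * -(Complex.I * n)) s := by
      have h3 : HasDerivAt (fun s : ℝ => -(Complex.I * (n : ℂ) * (s : ℂ)))
          (-(Complex.I * (n : ℂ) * ((1 : ℝ) : ℂ))) s :=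
        ((hasDerivAt_id s).ofReal_comp.const_mul (Complex.I * (n : ℂ))).neg
      refine h3.cexp.congr_deriv ?_
      simp [rotor]
    have h4 : (fun s => rotor n s * phasor n x s) =
        fun s => rotor n s * (((deriv x s : ℝ) : ℂ) + ((n * x s : ℝ) : ℂ) * Complex.I) := by
      funext s
      rw [phasor, Complex.mk_eq_add_mul_I]
    rw [h4]
    refine (h2.mul h1).congr_deriv ?_
    rw [← heq s]
    push_cast
    linear_combination (-(rotor n s * (n : ℂ) ^ 2 * (x s : ℂ))) * Complex.I_sq
  have := intervalIntegral.integral_eq_sub_of_hasDerivAt (a := 0) (b := t)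
    (fun s _ => key s) (Continuous.intervalIntegrable
      ((continuous_rotor n).mul (Complex.continuous_ofReal.comp hf)) _ _)
  rw [this, rotor_zero, one_mul]

theorem phasor_norm_le (n : ℕ) (hn : 1 ≤ n) (x : ℝ → ℝ) (t : ℝ) :
    ‖phasor n x t‖ ^ 2 ≤ (n : ℝ) ^ 2 * (|x t| ^ 2 + |deriv x t| ^ 2) := by
  have hn' : (1 : ℝ) ≤ (n : ℝ) ^ 2 := one_le_pow₀ (by exact_mod_cast hn)
  rw [← Complex.normSq_eq_norm_sq, Complex.normSq_apply, sq_abs, sq_abs]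
  simp only [phasor]
  nlinarith [mul_nonneg (sub_nonneg.2 hn') (sq_nonneg (deriv x t))]

/-! ### The square wave and its first Fourier coefficient -/

theorem Function.Periodic.integral_comp_nat_mul_add {E : Type*} [NormedAddCommGroup E]
    [NormedSpace ℝ E] {h : ℝ → E} (hh : Function.Periodic h (2 * π))
    (hint : ∀ a b, IntervalIntegrable h volume a b)
    (n : ℕ) (hn : 1 ≤ n) (θ : ℝ) :
    ∫ t in (0 : ℝ)..(2 * π), h (n * t + θ) = ∫ t in (0 : ℝ)..(2 * π), h t := by
  have hn' : (n : ℝ) ≠ 0 := by positivity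
  rw [intervalIntegral.integral_comp_mul_add h hn' θ]
  have h1 := hh.intervalIntegral_add_zsmul_eq n θ hint
  simp only [mul_zero, zero_add, natCast_zsmul, nsmul_eq_mul] at h1 ⊢
  rw [add_comm, h1, hh.intervalIntegral_add_eq θ 0, zero_add]
  rw [← Nat.cast_smul_eq_nsmul ℝ, smul_smul, inv_mul_cancel₀ hn', one_smul]

/-- The square wave, i.e. the sign of the sine. -/
noncomputable def squareWave (s : ℝ) : ℝ := if 0 ≤ sin s then 1 else -1

theorem measurable_squareWave : Measurable squareWave :=
  Measurable.ite (measurableSet_le measurable_const measurable_sin) measurable_const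
    measurable_const

theorem abs_squareWave (s : ℝ) : |squareWave s| = 1 := by
  unfold squareWave; split_ifs <;> simp

theorem squareWave_periodic : Function.Periodic squareWave (2 * π) := by
  intro s; simp [squareWave]

theorem intervalIntegrable_rotor_mul_squareWave (a b : ℝ) :
    IntervalIntegrable (fun s => rotor 1 s * (squareWave s : ℂ)) volume a b := by
  refine IntervalIntegrable.mono_fun (f := fun _ => (1 : ℝ)) ?_ ?_ ?_
  · exact intervalIntegrable_const
  · exact ((continuous_rotor 1).measurable.mul
      (Complex.measurable_ofReal.comp measurable_squareWave)).aestronglyMeasurable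
  · refine Eventually.of_forall fun s => ?_
    simp [norm_rotor, abs_squareWave]

theorem integral_rotor_mul_squareWave :
    ∫ s in (0 : ℝ)..(2 * π), rotor 1 s * (squareWave s : ℂ) = -4 * Complex.I := by
  have hI : ∀ a b : ℝ, ∫ s in a..b, rotor 1 s = Complex.I * (rotor 1 b - rotor 1 a) := by
    intro a b
    have := integral_exp_mul_complex (a := a) (b := b) (c := -Complex.I)
      (neg_ne_zero.2 Complex.I_ne_zero)
    simp only [rotor, Nat.cast_one, mul_one]
    simp only [neg_mul] at this
    rw [this]
    field_simp
    simp [Complex.I_sq]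
  have hpi : rotor 1 π = -1 := by
    simp only [rotor, Nat.cast_one, mul_one]
    rw [Complex.exp_neg, mul_comm, Complex.exp_pi_mul_I]; norm_num
  rw [← intervalIntegral.integral_add_adjacent_intervals
    (intervalIntegrable_rotor_mul_squareWave 0 π) (intervalIntegrable_rotor_mul_squareWave π (2 * π))]
  have h1 : ∫ s in (0 : ℝ)..π, rotor 1 s * (squareWave s : ℂ) = ∫ s in (0 : ℝ)..π, rotor 1 s := by
    refine intervalIntegral.integral_congr fun s hs => ?_
    rw [Set.uIcc_of_le pi_pos.le] at hs
    simp [squareWave, sin_nonneg_of_nonneg_of_le_pi hs.1 hs.2]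
  have h2 : ∫ s in π..(2 * π), rotor 1 s * (squareWave s : ℂ) =
      ∫ s in π..(2 * π), -rotor 1 s := by
    -- At the endpoint `2π` the sine vanishes and the square wave is `1`, so equality holds only
    -- almost everywhere.
    refine intervalIntegral.integral_congr_ae ?_
    filter_upwards [(Set.countable_singleton (2 * π)).ae_notMem volume] with s hs hs'
    rw [Set.uIoc_of_le (by linarith [pi_pos])] at hs'
    have h3 : s < 2 * π := lt_of_le_of_ne hs'.2 hs
    have h4 : sin s < 0 := by
      have := sin_pos_of_pos_of_lt_pi (x := s - π) (by linarith [hs'.1]) (by linarith)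
      rw [sin_sub_pi] at this; linarith
    simp [squareWave, not_le.2 h4]
  rw [h1, h2, intervalIntegral.integral_neg, hI, hI, rotor_two_pi, rotor_zero, hpi]
  ring

/-- The sets `|sin s| < η` shrink to the countable zero set of the sine; dominated convergence
applies. -/
theorem exists_integral_abs_sin_lt_le {ε : ℝ} (hε : 0 < ε) :
    ∃ η > 0, ∫ s in (0 : ℝ)..(2 * π), (if |sin s| < η then (1 : ℝ) else 0) ≤ ε := by
  have hlim : Tendsto (fun k : ℕ => ∫ s in (0 : ℝ)..(2 * π),
      (if |sin s| < 1 / ((k : ℝ) + 1) then (1 : ℝ) else 0)) atTop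
      (𝓝 (∫ _ in (0 : ℝ)..(2 * π), (0 : ℝ))) := by
    refine intervalIntegral.tendsto_integral_filter_of_dominated_convergence (fun _ => 1) ?_ ?_ ?_ ?_
    · refine Eventually.of_forall fun k => Measurable.aestronglyMeasurable ?_
      exact Measurable.ite (measurableSet_lt (by fun_prop) measurable_const) measurable_const
        measurable_const
    · refine Eventually.of_forall fun k => Eventually.of_forall fun s _ => ?_
      split_ifs <;> simp
    · exact intervalIntegrable_const
    · have hc : (Set.range fun m : ℤ => (m : ℝ) * π).Countable := Set.countable_range _
      filter_upwards [hc.ae_notMem volume] with s hs _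
      have hs' : 0 < |sin s| := by
        rw [abs_pos]
        intro h0
        obtain ⟨m, hm⟩ := sin_eq_zero_iff.1 h0
        exact hs ⟨m, hm⟩
      refine tendsto_const_nhds.congr' ?_
      filter_upwards [tendsto_one_div_add_atTop_nhds_zero_nat.eventually_lt_const hs'] with k hk
      rw [if_neg (not_lt.2 hk.le)]
  simp only [intervalIntegral.integral_zero] at hlim
  obtain ⟨k, hk⟩ := (hlim.eventually_le_const hε).exists
  exact ⟨1 / ((k : ℝ) + 1), by positivity, hk⟩

theorem rotor_eq_mul (n : ℕ) (t θ : ℝ) :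
    rotor n t = Complex.exp (θ * Complex.I) * rotor 1 (n * t + θ) := by
  simp only [rotor]
  rw [← Complex.exp_add]
  congr 1
  push_cast; ring

theorem rotor_periodic (n : ℕ) : Function.Periodic (rotor n) (2 * π) := by
  intro t
  have : rotor n (t + 2 * π) = rotor n t * rotor n (2 * π) := by
    simp only [rotor]
    rw [← Complex.exp_add]
    congr 1
    push_cast; ring
  rw [this, rotor_two_pi, mul_one]

theorem integral_rotor_mul_squareWave_comp (n : ℕ) (hn : 1 ≤ n) (θ : ℝ) :
    ∫ t in (0 : ℝ)..(2 * π), rotor n t * (squareWave (n * t + θ) : ℂ) =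
      -4 * Complex.I * Complex.exp (θ * Complex.I) := by
  have hper : Function.Periodic (fun s => rotor 1 s * (squareWave s : ℂ)) (2 * π) := by
    intro s
    simp only [rotor_periodic 1 s, squareWave_periodic s]
  have h := hper.integral_comp_nat_mul_add intervalIntegrable_rotor_mul_squareWave n hn θ
  rw [integral_rotor_mul_squareWave] at h
  have h2 : ∀ t : ℝ, rotor n t * (squareWave (n * t + θ) : ℂ) = Complex.exp (θ * Complex.I) *
      (rotor 1 (n * t + θ) * (squareWave (n * t + θ) : ℂ)) := by
    intro t
    rw [rotor_eq_mul n t θ]; ring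
  simp only [h2]
  rw [intervalIntegral.integral_const_mul, h]
  ring

/-! ### Averaging along a large oscillation -/

theorem phase_im (n : ℕ) (w : ℂ) (t : ℝ) :
    ((rotor n t)⁻¹ * w).im = ‖w‖ * sin (n * t + w.arg) := by
  have : (rotor n t)⁻¹ * w = ‖w‖ * Complex.exp ((n * t + w.arg : ℝ) * Complex.I) := by
    conv_lhs => rw [← Complex.norm_mul_exp_arg_mul_I w]
    simp only [rotor]
    rw [← Complex.exp_neg, neg_neg, mul_left_comm, ← Complex.exp_add]
    congr 2
    push_cast; ring
  rw [this, Complex.im_ofReal_mul, Complex.exp_ofReal_mul_I_im]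

/-- Away from the zeros of the sine, `y` lies beyond `±A`, where `φ` is `δ`-close to its limit; near
them the crude bound `2M` is used. -/
theorem abs_sub_squareWave_mul_le {φ : ℝ → ℝ} {L M A δ η : ℝ} (hM : ∀ s, |φ s| ≤ M)
    (hL : |L| ≤ M) (hδ : 0 ≤ δ) (hpos : ∀ s, A ≤ s → |φ s - L| ≤ δ)
    (hneg : ∀ s, s ≤ -A → |φ s + L| ≤ δ) {s r y : ℝ}
    (hr : r * η ≤ r * |sin s| → (0 ≤ r * sin s → A ≤ y) ∧ (r * sin s < 0 → y ≤ -A))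
    (hr0 : 0 < r) :
    |φ y - L * squareWave s| ≤ δ + 2 * M * (if |sin s| < η then (1 : ℝ) else 0) := by
  have hM0 : 0 ≤ M := (abs_nonneg _).trans hL
  split_ifs with h
  · have : |φ y - L * squareWave s| ≤ |φ y| + |L * squareWave s| := abs_sub _ _
    rw [abs_mul, abs_squareWave, mul_one] at this
    linarith [hM y]
  · obtain ⟨h1, h2⟩ := hr (mul_le_mul_of_nonneg_left (not_lt.1 h) hr0.le)
    unfold squareWave
    split_ifs with h3
    · simpa using hpos y (h1 (mul_nonneg hr0.le h3))
    · have := hneg y (h2 (mul_neg_of_pos_of_neg hr0 (not_le.1 h3)))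
      simpa using this

/-- Averaging a bounded nonlinearity with antipodal limits along a fast large oscillation yields
the first Fourier coefficient of a square wave. -/
theorem exists_norm_integral_rotor_mul_comp_add_le (n : ℕ) (hn : 1 ≤ n) {φ : ℝ → ℝ}
    (hφ : Continuous φ) {L M : ℝ} (hM : ∀ s, |φ s| ≤ M) (htop : Tendsto φ atTop (𝓝 L))
    (hbot : Tendsto φ atBot (𝓝 (-L))) (C : ℝ) {ε : ℝ} (hε : 0 < ε) :
    ∃ R > 0, ∀ (y : ℝ → ℝ) (w : ℂ), Continuous y → R ≤ ‖w‖ →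
      (∀ t ∈ Set.Icc 0 (2 * π), |n * y t - ((rotor n t)⁻¹ * w).im| ≤ C) →
      ‖(∫ t in (0 : ℝ)..(2 * π), rotor n t * (φ (y t) : ℂ)) + 4 * Complex.I * L * (w / ‖w‖)‖
        ≤ ε := by
  have hL : |L| ≤ M := le_of_tendsto htop.abs (Eventually.of_forall hM)
  have hM0 : 0 ≤ M := (abs_nonneg _).trans hL
  have hn' : (1 : ℝ) ≤ n := by exact_mod_cast hn
  -- Over a period `δ` contributes `ε/2`; the bad set chosen below contributes at most the other
  -- half, with `M + 1` allowing for `M = 0`.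
  set δ := ε / (4 * π) with hδ_def
  have hδ : 0 < δ := by positivity
  obtain ⟨A₁, hA₁⟩ := eventually_atTop.1 (htop.eventually (Metric.closedBall_mem_nhds L hδ))
  obtain ⟨A₂, hA₂⟩ := eventually_atBot.1 (hbot.eventually (Metric.closedBall_mem_nhds (-L) hδ))
  set A := |A₁| + |A₂| with hA
  have hpos : ∀ s, A ≤ s → |φ s - L| ≤ δ := fun s hs => by
    have := hA₁ s (by linarith [le_abs_self A₁, abs_nonneg A₂])
    rwa [Real.dist_eq] at this
  have hneg : ∀ s, s ≤ -A → |φ s + L| ≤ δ := fun s hs => by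
    have := hA₂ s (by linarith [neg_abs_le A₂, abs_nonneg A₁])
    rwa [Real.dist_eq, sub_neg_eq_add] at this
  obtain ⟨η, hη, hbad⟩ := exists_integral_abs_sin_lt_le
    (show 0 < ε / (4 * (M + 1)) by positivity)
  have hA0 : 0 ≤ A := by positivity
  -- Where `|sin| ≥ η` the free oscillation exceeds `nA + |C|`, so `|n y| ≥ nA` survives the error
  -- `C`.
  refine ⟨(n * A + |C| + 1) / η, by positivity, fun y w hy hw hyw => ?_⟩
  have hR : n * A + |C| + 1 ≤ ‖w‖ * η := by rwa [div_le_iff₀ hη] at hw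
  have hw0 : 0 < ‖w‖ := lt_of_lt_of_le (by positivity) hw
  set θ := w.arg
  have hwθ : w / ‖w‖ = Complex.exp (θ * Complex.I) := by
    have : (‖w‖ : ℂ) ≠ 0 := by exact_mod_cast hw0.ne'
    rw [div_eq_iff this, mul_comm, Complex.norm_mul_exp_arg_mul_I]
  have hmeas : Measurable fun t : ℝ => squareWave (n * t + θ) :=
    measurable_squareWave.comp (by fun_prop)
  have hint1 : IntervalIntegrable (fun t => rotor n t * (φ (y t) : ℂ)) volume 0 (2 * π) :=
    ((continuous_rotor n).mul
      (Complex.continuous_ofReal.comp (hφ.comp hy))).intervalIntegrable _ _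
  have hint2 : IntervalIntegrable (fun t => rotor n t * (squareWave (n * t + θ) : ℂ)) volume
      0 (2 * π) := by
    refine IntervalIntegrable.mono_fun (f := fun _ => (1 : ℝ)) intervalIntegrable_const
      ((continuous_rotor n).measurable.mul
        (Complex.measurable_ofReal.comp hmeas)).aestronglyMeasurable ?_
    exact Eventually.of_forall fun s => by simp [norm_rotor, abs_squareWave]
  have hind : ∀ a b, IntervalIntegrable (fun s => if |sin s| < η then (1 : ℝ) else 0) volume
      a b := by
    intro a b
    refine IntervalIntegrable.mono_fun (f := fun _ => (1 : ℝ)) intervalIntegrable_const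
      (Measurable.aestronglyMeasurable ?_) ?_
    · exact Measurable.ite (measurableSet_lt (by fun_prop) measurable_const) measurable_const
        measurable_const
    · refine Eventually.of_forall fun s => ?_
      dsimp only
      split_ifs <;> simp
  have hind_comp : IntervalIntegrable (fun t => if |sin (n * t + θ)| < η then (1 : ℝ) else 0)
      volume 0 (2 * π) := by
    refine IntervalIntegrable.mono_fun (f := fun _ => (1 : ℝ)) intervalIntegrable_const
      (Measurable.aestronglyMeasurable ?_) ?_
    · exact Measurable.ite (measurableSet_lt (by fun_prop) measurable_const) measurable_const
        measurable_const
    · refine Eventually.of_forall fun s => ?_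
      dsimp only
      split_ifs <;> simp
  have hsplit : (∫ t in (0 : ℝ)..(2 * π), rotor n t * (φ (y t) : ℂ)) +
      4 * Complex.I * L * (w / ‖w‖) = ∫ t in (0 : ℝ)..(2 * π),
        rotor n t * ((φ (y t) - L * squareWave (n * t + θ) : ℝ) : ℂ) := by
    have : ∀ t, rotor n t * ((φ (y t) - L * squareWave (n * t + θ) : ℝ) : ℂ) =
        rotor n t * (φ (y t) : ℂ) - L * (rotor n t * (squareWave (n * t + θ) : ℂ)) := by
      intro t; push_cast; ring
    simp only [this]
    rw [intervalIntegral.integral_sub hint1 (hint2.const_mul _),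
      intervalIntegral.integral_const_mul, integral_rotor_mul_squareWave_comp n hn, hwθ]
    ring
  rw [hsplit]
  have hbound : ∀ t ∈ Set.Ioc 0 (2 * π),
      ‖rotor n t * ((φ (y t) - L * squareWave (n * t + θ) : ℝ) : ℂ)‖ ≤
        δ + 2 * M * (if |sin (n * t + θ)| < η then (1 : ℝ) else 0) := by
    intro t ht
    rw [norm_mul, norm_rotor, one_mul, Complex.norm_real, Real.norm_eq_abs]
    refine abs_sub_squareWave_mul_le hM hL hδ.le hpos hneg (r := ‖w‖) (fun h => ?_) hw0
    have h1 := hyw t ⟨ht.1.le, ht.2⟩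
    rw [phase_im] at h1
    rw [← abs_of_pos hw0, ← abs_mul, abs_of_pos hw0] at h
    have h2 := abs_le.1 (h1.trans (le_abs_self C))
    constructor
    · intro h3
      rw [abs_of_nonneg h3] at h
      have : n * A ≤ n * y t := by linarith
      exact le_of_mul_le_mul_left this (by linarith)
    · intro h3
      rw [abs_of_neg h3] at h
      have : n * y t ≤ n * (-A) := by linarith
      exact le_of_mul_le_mul_left this (by linarith)
  refine (intervalIntegral.norm_integral_le_of_norm_le two_pi_pos.le
    (Eventually.of_forall hbound)
    (intervalIntegrable_const.add (hind_comp.const_mul _))).trans ?_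
  have hper : Function.Periodic (fun s => if |sin s| < η then (1 : ℝ) else 0) (2 * π) := by
    intro s; simp
  rw [intervalIntegral.integral_add intervalIntegrable_const (hind_comp.const_mul _),
    intervalIntegral.integral_const_mul, intervalIntegral.integral_const,
    hper.integral_comp_nat_mul_add hind n hn θ]
  have h1 : (2 * π - 0) • δ = ε / 2 := by
    rw [hδ_def, smul_eq_mul]; field_simp; ring
  have h2 : 2 * M * ∫ s in (0 : ℝ)..(2 * π), (if |sin s| < η then (1 : ℝ) else 0) ≤ ε / 2 := by
    calc _ ≤ 2 * M * (ε / (4 * (M + 1))) := by gcongr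
      _ ≤ ε / 2 := by
        rw [mul_div_assoc', div_le_div_iff₀ (by positivity) (by positivity)]
        nlinarith
  rw [h1]; linarith

/-! ### The time-`2π` map far from the origin -/

theorem conj_pHat (p : ℝ → ℝ) (n : ℕ) :
    conj (pHat p n) = ∫ t in (0 : ℝ)..(2 * π), rotor n t * (p t : ℂ) := by
  unfold pHat
  rw [intervalIntegral.integral_of_le two_pi_pos.le, intervalIntegral.integral_of_le two_pi_pos.le,
    ← integral_conj]
  refine integral_congr_ae (Eventually.of_forall fun t => ?_)
  simp [rotor, ← Complex.exp_conj, mul_comm]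

theorem norm_rotor_mul_phasor_sub_le (n : ℕ) {x f : ℝ → ℝ} (hx : Differentiable ℝ x)
    (hx' : Differentiable ℝ (deriv x)) (hf : Continuous f)
    (heq : ∀ t, deriv (deriv x) t + (n : ℝ) ^ 2 * x t = f t) {M : ℝ} (hM : ∀ t, |f t| ≤ M)
    {t : ℝ} (ht : t ∈ Set.Icc 0 (2 * π)) :
    ‖rotor n t * phasor n x t - phasor n x 0‖ ≤ M * (2 * π) := by
  rw [rotor_mul_phasor_sub n x f hx hx' hf heq]
  refine (intervalIntegral.norm_integral_le_of_norm_le_const (C := M) fun s _ => ?_).trans ?_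
  · rw [norm_mul, norm_rotor, one_mul, Complex.norm_real]
    exact hM s
  · rw [sub_zero, abs_of_nonneg ht.1]
    exact mul_le_mul_of_nonneg_left ht.2 ((abs_nonneg _).trans (hM 0))

theorem abs_sub_im_inv_rotor_mul_le (n : ℕ) {x : ℝ → ℝ} {t C : ℝ} {w : ℂ}
    (h : ‖rotor n t * phasor n x t - w‖ ≤ C) : |n * x t - ((rotor n t)⁻¹ * w).im| ≤ C := by
  have h1 : n * x t - ((rotor n t)⁻¹ * w).im =
      ((rotor n t)⁻¹ * (rotor n t * phasor n x t - w)).im := by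
    rw [mul_sub, inv_mul_cancel_left₀ (rotor_ne_zero n t)]
    simp [phasor]
  rw [h1]
  refine (Complex.abs_im_le_norm _).trans ?_
  rwa [norm_mul, norm_inv, norm_rotor, inv_one, one_mul]

/-- The asymptotic form of the time-`2π` map of one forced oscillator. -/
theorem exists_norm_phasor_two_pi_sub_le (n : ℕ) (hn : 1 ≤ n) {φ p : ℝ → ℝ}
    (hφ : Continuous φ) (hp : Continuous p) {L M : ℝ} (hM : ∀ s, |φ s| ≤ M)
    (htop : Tendsto φ atTop (𝓝 L)) (hbot : Tendsto φ atBot (𝓝 (-L))) (C : ℝ) {ε : ℝ}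
    (hε : 0 < ε) :
    ∃ R > 0, ∀ x y : ℝ → ℝ, Differentiable ℝ x → Differentiable ℝ (deriv x) → Continuous y →
      (∀ t, deriv (deriv x) t + (n : ℝ) ^ 2 * x t = p t - φ (y t)) →
      (∀ t ∈ Set.Icc 0 (2 * π), ‖rotor n t * phasor n y t - phasor n y 0‖ ≤ C) →
      R ≤ ‖phasor n y 0‖ →
      ‖phasor n x (2 * π) - phasor n x 0 -
        (conj (pHat p n) + 4 * Complex.I * L * (phasor n y 0 / ‖phasor n y 0‖))‖ ≤ ε := by
  obtain ⟨R, hR, h⟩ := exists_norm_integral_rotor_mul_comp_add_le n hn hφ hM htop hbot C hε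
  refine ⟨R, hR, fun x y hx hx' hy heq hyC hyR => ?_⟩
  have h1 := h y _ hy hyR fun t ht => abs_sub_im_inv_rotor_mul_le n (hyC t ht)
  have hφy : Continuous fun t => φ (y t) := hφ.comp hy
  have h2 := rotor_mul_phasor_sub n x (fun t => p t - φ (y t)) hx hx' (hp.sub hφy) heq (2 * π)
  rw [rotor_two_pi, one_mul] at h2
  have hi₁ : IntervalIntegrable (fun t => rotor n t * (p t : ℂ)) volume 0 (2 * π) :=
    ((continuous_rotor n).mul (Complex.continuous_ofReal.comp hp)).intervalIntegrable _ _
  have hi₂ : IntervalIntegrable (fun t => rotor n t * (φ (y t) : ℂ)) volume 0 (2 * π) :=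
    ((continuous_rotor n).mul (Complex.continuous_ofReal.comp hφy)).intervalIntegrable _ _
  have h3 : (∫ s in (0 : ℝ)..(2 * π), rotor n s * ((p s - φ (y s) : ℝ) : ℂ)) =
      conj (pHat p n) - ∫ s in (0 : ℝ)..(2 * π), rotor n s * (φ (y s) : ℂ) := by
    rw [conj_pHat, ← intervalIntegral.integral_sub hi₁ hi₂]
    simp only [Complex.ofReal_sub, mul_sub]
  rw [h2, h3, ← norm_neg]
  refine le_of_eq_of_le (congrArg norm ?_) h1
  ring

/-! ### The wedge and its forward invariance -/

/-- The product of a half plane with a truncated cone. -/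
def InWedge (e₀ e₁ : ℂ) (r : ℝ) (u v : ℂ) : Prop :=
  r ≤ (conj e₀ * u).re ∧ r ≤ (conj e₁ * v).re ∧ 3 / 5 * ‖v‖ ≤ (conj e₁ * v).re

theorem re_conj_mul_le_norm {e u : ℂ} (he : ‖e‖ = 1) : (conj e * u).re ≤ ‖u‖ := by
  refine (Complex.re_le_norm _).trans ?_
  rw [norm_mul, Complex.norm_conj, he, one_mul]

/-- Seen from the origin, the disc of radius `(4/5)ρ` about `ρe` has half-angle `arcsin (4/5)`,
whose cosine is `3/5`. -/
theorem cone_of_norm_sub_le {e d : ℂ} (he : ‖e‖ = 1) {ρ : ℝ} (hρ : 0 ≤ ρ)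
    (h : ‖d - ρ * e‖ ≤ 4 / 5 * ρ) :
    ρ / 5 ≤ (conj e * d).re ∧ 3 / 5 * ‖d‖ ≤ (conj e * d).re := by
  set z := conj e * d with hz
  have he2 : conj e * e = 1 := by
    rw [mul_comm, Complex.mul_conj, Complex.normSq_eq_norm_sq, he]; simp
  have h1 : ‖z - ρ‖ = ‖d - ρ * e‖ := by
    rw [← one_mul ‖d - ρ * e‖, ← he, ← Complex.norm_conj e, ← norm_mul, hz]
    congr 1
    linear_combination (ρ : ℂ) * he2
  have h2 : ‖z‖ = ‖d‖ := by rw [hz, norm_mul, Complex.norm_conj, he, one_mul]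
  rw [← h1] at h
  rw [← h2]
  have h3 : ‖z - ρ‖ ^ 2 ≤ (4 / 5 * ρ) ^ 2 := by gcongr
  rw [← Complex.normSq_eq_norm_sq, Complex.normSq_apply] at h3
  simp only [Complex.sub_re, Complex.sub_im, Complex.ofReal_re, Complex.ofReal_im, sub_zero] at h3
  have h4 : |z.re - ρ| ≤ 4 / 5 * ρ := abs_le_of_sq_le_sq (by nlinarith [sq_nonneg z.im])
    (by positivity)
  have h5 : ρ / 5 ≤ z.re := by linarith [(abs_le.1 h4).1]
  refine ⟨h5, ?_⟩
  refine le_of_sq_le_sq ?_ (by linarith)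
  rw [mul_pow, ← Complex.normSq_eq_norm_sq, Complex.normSq_apply]
  -- The square vanishes at the points of tangency, where `z.re = (9/25)ρ`.
  nlinarith [sq_nonneg (25 * z.re - 9 * ρ)]

/-- The cone is closed under addition by the triangle inequality; the lower bounds on real parts
add. -/
theorem InWedge.add {e₀ e₁ u v d c : ℂ} {r δ : ℝ} (h : InWedge e₀ e₁ r u v)
    (hd : δ ≤ (conj e₀ * d).re) (hc : δ ≤ (conj e₁ * c).re)
    (hc' : 3 / 5 * ‖c‖ ≤ (conj e₁ * c).re) : InWedge e₀ e₁ (r + δ) (u + d) (v + c) := by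
  obtain ⟨h1, h2, h3⟩ := h
  refine ⟨?_, ?_, ?_⟩ <;> rw [mul_add, Complex.add_re]
  · linarith
  · linarith
  · linarith [norm_add_le v c]

namespace IsOscillatorSolution

variable {n : ℕ} {a b : Fin 2 → ℝ} {p φ x : Fin 2 → ℝ → ℝ}

theorem resonant_equation (h : IsOscillatorSolution a b φ p x) (ha : ∀ i, a i = (n : ℝ) ^ 2)
    (hb : ∀ i, b i = (n : ℝ) ^ 2) (i : Fin 2) (t : ℝ) :
    deriv (deriv (x i)) t + (n : ℝ) ^ 2 * x i t = p i t - φ i (x (i + 1) t) := by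
  have h1 := h.equation i t
  have h2 := posPart_sub_negPart (x i t)
  rw [ha, hb] at h1
  rw [← h1]
  linear_combination (-(n : ℝ) ^ 2) * h2

theorem comp_add_const (h : IsOscillatorSolution a b φ p x) {c : ℝ}
    (hc : ∀ i, Function.Periodic (p i) c) :
    IsOscillatorSolution a b φ p (fun i t => x i (t + c)) := by
  have hd : ∀ i, deriv (fun t => x i (t + c)) = fun t => deriv (x i) (t + c) := fun i => by
    funext t; exact deriv_comp_add_const (x i) c t
  refine ⟨fun i => ?_, fun i => ?_, fun i t => ?_⟩
  · exact (h.differentiable i).comp (differentiable_id.add_const c)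
  · rw [hd]
    exact (h.differentiable_deriv i).comp (differentiable_id.add_const c)
  · rw [hd, deriv_comp_add_const (deriv (x i)) c t, ← hc i t]
    exact h.equation i (t + c)

theorem comp_neg (h : IsOscillatorSolution a b φ p x) :
    IsOscillatorSolution a b φ (fun i t => p i (-t)) (fun i t => x i (-t)) := by
  have hd : ∀ i, deriv (fun t => x i (-t)) = fun t => -deriv (x i) (-t) := fun i => by
    funext t; exact deriv_comp_neg (x i) t
  refine ⟨fun i => ?_, fun i => ?_, fun i t => ?_⟩
  · exact (h.differentiable i).comp differentiable_neg
  · rw [hd]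
    exact ((h.differentiable_deriv i).comp differentiable_neg).neg
  · rw [hd, deriv.fun_neg, deriv_comp_neg (deriv (x i)) t, neg_neg]
    exact h.equation i (-t)

end IsOscillatorSolution

theorem exists_abs_eq_one_mul_eq_abs (c : ℝ) : ∃ s : ℝ, |s| = 1 ∧ s * c = |c| := by
  rcases le_total 0 c with h | h
  · exact ⟨1, by simp, by rw [one_mul, abs_of_nonneg h]⟩
  · exact ⟨-1, by simp, by rw [neg_one_mul, abs_of_nonpos h]⟩

theorem exists_abs_le_of_continuous_periodic {p : ℝ → ℝ} (hp : Continuous p)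
    (hper : Function.Periodic p (2 * π)) : ∃ M, ∀ t, |p t| ≤ M := by
  obtain ⟨M, hM⟩ := (Function.Periodic.compact_of_continuous hper two_pi_pos.ne' hp).isBounded.exists_norm_le
  exact ⟨M, fun t => hM _ ⟨t, rfl⟩⟩

/-- After one period, every solution that starts far out in a suitable wedge has moved deeper into
this wedge by a fixed amount. -/
theorem exists_wedge_step (n : ℕ) (hn : 1 ≤ n) (a b : Fin 2 → ℝ)
    (ha : ∀ i, a i = (n : ℝ) ^ 2) (hb : ∀ i, b i = (n : ℝ) ^ 2)
    (p : Fin 2 → ℝ → ℝ) (hp_cont : ∀ i, Continuous (p i))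
    (hp_per : ∀ i, Function.Periodic (p i) (2 * π))
    (hp0 : pHat (p 0) n = 0)
    (φ : Fin 2 → ℝ → ℝ) (hφ : ∀ i, Continuous (φ i))
    (hφ_bdd : ∀ i, ∃ M : ℝ, ∀ s, |φ i s| ≤ M)
    (φlim : Fin 2 → ℝ) (hφ_top : ∀ i, Tendsto (φ i) atTop (𝓝 (φlim i)))
    (hφ_bot : ∀ i, Tendsto (φ i) atBot (𝓝 (-φlim i)))
    (hφ0 : φlim 0 ≠ 0) (hφ1 : |φlim 1| < 3 / 16 * ‖pHat (p 1) n‖) :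
    ∃ (e₀ e₁ : ℂ) (R δ C : ℝ), ‖e₀‖ = 1 ∧ ‖e₁‖ = 1 ∧ 0 < δ ∧
      ∀ x, IsOscillatorSolution a b φ p x →
        (∀ i, ∀ t ∈ Set.Icc 0 (2 * π),
          ‖rotor n t * phasor n (x i) t - phasor n (x i) 0‖ ≤ C) ∧
        ∀ r, R ≤ r → InWedge e₀ e₁ r (phasor n (x 0) 0) (phasor n (x 1) 0) →
          InWedge e₀ e₁ (r + δ) (phasor n (x 0) (2 * π)) (phasor n (x 1) (2 * π)) := by
  choose Mφ hMφ using hφ_bdd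
  choose Mp hMp using fun i => exists_abs_le_of_continuous_periodic (hp_cont i) (hp_per i)
  set C := (Mp 0 + Mφ 0 + (Mp 1 + Mφ 1)) * (2 * π) with hC
  have hM0 : ∀ i, 0 ≤ Mp i + Mφ i := fun i =>
    add_nonneg ((abs_nonneg _).trans (hMp i 0)) ((abs_nonneg _).trans (hMφ i 0))
  set P := conj (pHat (p 1) n) with hP
  have hPn : ‖pHat (p 1) n‖ = ‖P‖ := (Complex.norm_conj _).symm
  rw [hPn] at hφ1
  have hP0 : 0 < ‖P‖ := by linarith [abs_nonneg (φlim 1)]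
  have hL0 : 0 < |φlim 0| := abs_pos.2 hφ0
  set e₁ := P / ‖P‖ with he₁
  have hPe : P = ‖P‖ * e₁ := by
    rw [he₁, mul_div_cancel₀]
    exact_mod_cast hP0.ne'
  have hne₁ : ‖e₁‖ = 1 := by
    rw [he₁, norm_div, Complex.norm_real, norm_norm, div_self hP0.ne']
  obtain ⟨s, hs, hsL⟩ := exists_abs_eq_one_mul_eq_abs (φlim 0)
  -- For `v` along `e₁` the leading step `4iL₀ v/‖v‖` of `u` is `4|L₀| e₀`; here `s` is the sign of
  -- `L₀ = φlim 0`.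
  set e₀ := Complex.I * s * e₁ with he₀
  have hne₀ : ‖e₀‖ = 1 := by
    rw [he₀, norm_mul, norm_mul, Complex.norm_I, Complex.norm_real, Real.norm_eq_abs, hs, hne₁]
    norm_num
  -- The tolerance `|L₀|` is below the gain `(12/5)|L₀|` of `u`; the tolerance `‖P‖/20` fits because
  -- `4 · 3/16 + 1/20 = 4/5`.
  obtain ⟨R₀, hR₀, hstep₀⟩ := exists_norm_phasor_two_pi_sub_le n hn (hφ 0) (hp_cont 0) (hMφ 0)
    (hφ_top 0) (hφ_bot 0) C hL0
  obtain ⟨R₁, hR₁, hstep₁⟩ := exists_norm_phasor_two_pi_sub_le n hn (hφ 1) (hp_cont 1) (hMφ 1)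
    (hφ_top 1) (hφ_bot 1) C (show 0 < ‖P‖ / 20 by positivity)
  refine ⟨e₀, e₁, max R₀ R₁, min |φlim 0| (‖P‖ / 5), C, hne₀, hne₁,
    lt_min hL0 (by positivity), fun x hx => ?_⟩
  have hcont : ∀ i, Continuous (x i) := fun i => (hx.differentiable i).continuous
  have heq := hx.resonant_equation ha hb
  have hdrift : ∀ i, ∀ t ∈ Set.Icc 0 (2 * π),
      ‖rotor n t * phasor n (x i) t - phasor n (x i) 0‖ ≤ C := by
    intro i t ht
    refine (norm_rotor_mul_phasor_sub_le n (hx.differentiable i) (hx.differentiable_deriv i)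
      (f := fun t => p i t - φ i (x (i + 1) t)) ((hp_cont i).sub ((hφ i).comp (hcont _))) (heq i)
      (M := Mp i + Mφ i) (fun t => ?_) ht).trans ?_
    · exact (abs_sub _ _).trans (add_le_add (hMp i t) (hMφ i _))
    · refine mul_le_mul_of_nonneg_right ?_ two_pi_pos.le
      fin_cases i
      · simpa using hM0 1
      · simpa using hM0 0
  refine ⟨hdrift, fun r hr hw => ?_⟩
  obtain ⟨hw0, hw1, hw2⟩ := id hw
  have hu : R₁ ≤ ‖phasor n (x 0) 0‖ :=
    ((le_max_right _ _).trans hr).trans (hw0.trans (re_conj_mul_le_norm hne₀))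
  have hv : R₀ ≤ ‖phasor n (x 1) 0‖ :=
    ((le_max_left _ _).trans hr).trans (hw1.trans (re_conj_mul_le_norm hne₁))
  have hd₀ := hstep₀ (x 0) (x 1) (hx.differentiable 0) (hx.differentiable_deriv 0) (hcont 1)
    (heq 0) (hdrift 1) hv
  have hd₁ := hstep₁ (x 1) (x 0) (hx.differentiable 1) (hx.differentiable_deriv 1) (hcont 0)
    (heq 1) (hdrift 0) hu
  set u := phasor n (x 0) 0
  set v := phasor n (x 1) 0
  set u' := phasor n (x 0) (2 * π)
  set v' := phasor n (x 1) (2 * π)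
  have hu0 : 0 < ‖u‖ := hR₁.trans_le hu
  have hv0 : 0 < ‖v‖ := hR₀.trans_le hv
  have hcone : ‖v' - v - (‖P‖ : ℝ) * e₁‖ ≤ 4 / 5 * ‖P‖ := by
    rw [← hPe]
    have h1 : ‖4 * Complex.I * (φlim 1 : ℂ) * (u / ‖u‖)‖ = 4 * |φlim 1| := by
      simp [hu0.ne']
    have h2 : v' - v - P = (v' - v - (P + 4 * Complex.I * (φlim 1 : ℂ) * (u / ‖u‖))) +
        4 * Complex.I * (φlim 1 : ℂ) * (u / ‖u‖) := by ring
    rw [h2]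
    refine (norm_add_le _ _).trans ?_
    rw [h1]
    linarith
  obtain ⟨hc1, hc2⟩ := cone_of_norm_sub_le hne₁ hP0.le hcone
  -- Along `e₀` the leading step is `4|L₀| Re(conj e₁ · v)/‖v‖`, at least `(12/5)|L₀|` by the cone
  -- condition on `v`.
  have hhalf : |φlim 0| ≤ (conj e₀ * (u' - u)).re := by
    rw [hp0, map_zero, zero_add] at hd₀
    have h1 : conj e₀ * (4 * Complex.I * (φlim 0 : ℂ) * (v / ‖v‖)) =
        ((4 * |φlim 0| / ‖v‖ : ℝ) : ℂ) * (conj e₁ * v) := by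
      rw [he₀, map_mul, map_mul, Complex.conj_I, Complex.conj_ofReal, ← hsL]
      push_cast
      linear_combination (-(4 * s * (φlim 0 : ℂ) / ‖v‖ * (conj e₁ * v))) * Complex.I_sq
    have h2 := re_conj_mul_le_norm (u := -(u' - u - 4 * Complex.I * (φlim 0 : ℂ) * (v / ‖v‖))) hne₀
    rw [norm_neg, neg_sub, mul_sub, h1, Complex.sub_re, Complex.re_ofReal_mul] at h2
    have h3 : 4 * |φlim 0| / ‖v‖ * (3 / 5 * ‖v‖) ≤ 4 * |φlim 0| / ‖v‖ * (conj e₁ * v).re :=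
      mul_le_mul_of_nonneg_left hw2 (by positivity)
    have h4 : 4 * |φlim 0| / ‖v‖ * (3 / 5 * ‖v‖) = 12 / 5 * |φlim 0| := by
      field_simp; norm_num
    linarith
  have := hw.add (δ := min |φlim 0| (‖P‖ / 5)) ((min_le_left _ _).trans hhalf)
    ((min_le_right _ _).trans hc1) hc2
  simpa using this

/-! ### From one period to all times -/

theorem phasor_comp_add_const (n : ℕ) (x : ℝ → ℝ) (c t : ℝ) :
    phasor n (fun t => x (t + c)) t = phasor n x (t + c) := by
  simp only [phasor, deriv_comp_add_const]

theorem tendsto_energy_of_phasor (n : ℕ) (hn : 1 ≤ n) {x : ℝ → ℝ}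
    (h : Tendsto (fun t => ‖phasor n x t‖) atTop atTop) :
    Tendsto (fun t => |x t| ^ 2 + |deriv x t| ^ 2) atTop atTop := by
  have hn' : (0 : ℝ) < (n : ℝ) ^ 2 := by positivity
  refine tendsto_atTop_mono (fun t => ?_)
    (((tendsto_pow_atTop two_ne_zero).comp h).atTop_div_const hn')
  rw [Function.comp_apply, div_le_iff₀ hn', mul_comm]
  exact phasor_norm_le n hn x t

/-- If the wedge condition improves by a fixed amount over every period, both components tend to
infinity in norm. -/
theorem tendsto_phasor_of_wedge_step {n : ℕ} {e₀ e₁ : ℂ} {R δ C : ℝ} (he₀ : ‖e₀‖ = 1)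
    (he₁ : ‖e₁‖ = 1) (hδ : 0 < δ) {x : Fin 2 → ℝ → ℝ}
    (hdrift : ∀ k : ℕ, ∀ i, ∀ t ∈ Set.Icc 0 (2 * π),
      ‖rotor n t * phasor n (x i) (t + k * (2 * π)) - phasor n (x i) (k * (2 * π))‖ ≤ C)
    (hstep : ∀ k : ℕ, ∀ r, R ≤ r →
      InWedge e₀ e₁ r (phasor n (x 0) (k * (2 * π))) (phasor n (x 1) (k * (2 * π))) →
      InWedge e₀ e₁ (r + δ) (phasor n (x 0) (2 * π + k * (2 * π)))
        (phasor n (x 1) (2 * π + k * (2 * π))))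
    (h0 : InWedge e₀ e₁ R (phasor n (x 0) 0) (phasor n (x 1) 0)) (i : Fin 2) :
    Tendsto (fun t => ‖phasor n (x i) t‖) atTop atTop := by
  have hk : ∀ k : ℕ, InWedge e₀ e₁ (R + k * δ) (phasor n (x 0) (k * (2 * π)))
      (phasor n (x 1) (k * (2 * π))) := by
    intro k
    induction k with
    | zero => simpa using h0
    | succ k ih =>
      have := hstep k _ (le_add_of_nonneg_right (by positivity)) ih
      rwa [add_assoc, ← add_one_mul, add_comm (2 * π), ← add_one_mul, ← Nat.cast_succ] at this
  have hnorm : ∀ k : ℕ, R + k * δ ≤ ‖phasor n (x i) (k * (2 * π))‖ := by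
    intro k
    fin_cases i
    · exact (hk k).1.trans (re_conj_mul_le_norm he₀)
    · exact (hk k).2.1.trans (re_conj_mul_le_norm he₁)
  -- At a time inside period `k` the norm is at least its value at the start of that period minus
  -- the drift `C`.
  have hfloor : Tendsto (fun t : ℝ => R - C + (⌊t / (2 * π)⌋₊ : ℝ) * δ) atTop atTop := by
    refine tendsto_atTop_add_const_left _ _ (Tendsto.atTop_mul_const hδ ?_)
    exact tendsto_natCast_atTop_atTop.comp
      (tendsto_nat_floor_atTop.comp (tendsto_id.atTop_div_const two_pi_pos))
  refine tendsto_atTop_mono' _ ?_ hfloor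
  filter_upwards [eventually_ge_atTop 0] with t ht
  set k := ⌊t / (2 * π)⌋₊
  have h1 : (k : ℝ) * (2 * π) ≤ t := by
    rw [← le_div_iff₀ two_pi_pos]
    exact Nat.floor_le (by positivity)
  have h2 : t ≤ (k + 1 : ℝ) * (2 * π) := by
    rw [← div_le_iff₀ two_pi_pos]
    exact (Nat.lt_floor_add_one _).le
  have h3 := hdrift k i (t - k * (2 * π)) ⟨by linarith, by linarith⟩
  rw [sub_add_cancel] at h3
  have h4 := norm_sub_norm_le (phasor n (x i) (k * (2 * π)))
    (phasor n (x i) (k * (2 * π)) - rotor n (t - k * (2 * π)) * phasor n (x i) t)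
  rw [sub_sub_cancel, norm_mul, norm_rotor, one_mul, norm_sub_rev] at h4
  linarith [hnorm k, norm_sub_rev (phasor n (x i) (k * (2 * π)))
    (rotor n (t - k * (2 * π)) * phasor n (x i) t)]

/-! ### The measure of the set of initial data -/

/-- The phasor of an initial datum. -/
def datumPhasor (n : ℕ) (i : Fin 2) (d : (Fin 2 → ℝ) × (Fin 2 → ℝ)) : ℂ := ⟨d.2 i, n * d.1 i⟩

theorem continuous_datumPhasor (n : ℕ) (i : Fin 2) : Continuous (datumPhasor n i) := by
  have : datumPhasor n i = fun d => ((d.2 i : ℝ) : ℂ) + ((n * d.1 i : ℝ) : ℂ) * Complex.I := by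
    funext d; rw [datumPhasor, Complex.mk_eq_add_mul_I]
  rw [this]
  fun_prop

/-- The initial data whose phasors lie in a wedge. -/
def wedgeData (n : ℕ) (e₀ e₁ : ℂ) (r : ℝ) : Set ((Fin 2 → ℝ) × (Fin 2 → ℝ)) :=
  {d | InWedge e₀ e₁ r (datumPhasor n 0 d) (datumPhasor n 1 d)}

theorem measurableSet_wedgeData (n : ℕ) (e₀ e₁ : ℂ) (r : ℝ) :
    MeasurableSet (wedgeData n e₀ e₁ r) := by
  have h0 := continuous_datumPhasor n 0
  have h1 := continuous_datumPhasor n 1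
  refine IsClosed.measurableSet ?_
  refine (isClosed_le continuous_const (Complex.continuous_re.comp (continuous_const.mul h0))).inter
    ((isClosed_le continuous_const (Complex.continuous_re.comp (continuous_const.mul h1))).inter
    (isClosed_le (continuous_const.mul h1.norm)
      (Complex.continuous_re.comp (continuous_const.mul h1))))

theorem norm_datumPhasor_sub_le (n : ℕ) (hn : 1 ≤ n) (i : Fin 2)
    (d d' : (Fin 2 → ℝ) × (Fin 2 → ℝ)) :
    ‖datumPhasor n i d - datumPhasor n i d'‖ ≤ 2 * n * ‖d - d'‖ := by
  have hn' : (1 : ℝ) ≤ n := by exact_mod_cast hn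
  have h1 : |d.1 i - d'.1 i| ≤ ‖d - d'‖ :=
    (norm_le_pi_norm (d - d').1 i).trans (norm_fst_le (d - d'))
  have h2 : |d.2 i - d'.2 i| ≤ ‖d - d'‖ :=
    (norm_le_pi_norm (d - d').2 i).trans (norm_snd_le (d - d'))
  refine (Complex.norm_le_abs_re_add_abs_im _).trans ?_
  simp only [datumPhasor, Complex.sub_re, Complex.sub_im]
  rw [← mul_sub, abs_mul, Nat.abs_cast]
  nlinarith [norm_nonneg (d - d')]

theorem volume_wedgeData (n : ℕ) (hn : 1 ≤ n) {e₀ e₁ : ℂ} (he₀ : ‖e₀‖ = 1) (he₁ : ‖e₁‖ = 1)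
    (R : ℝ) : volume (wedgeData n e₀ e₁ R) = ⊤ := by
  have hn' : (1 : ℝ) ≤ n := by exact_mod_cast hn
  have hball : ∀ r : ℝ, 0 ≤ r → ∃ c, Metric.closedBall c r ⊆ wedgeData n e₀ e₁ R := by
    intro r hr
    -- A datum in the ball has phasors within `ρ = 2nr` of `l e₀`, `l e₁`. The cone condition needs
    -- `l - ρ ≥ (3/5)(l + ρ)`, that is `l ≥ 4ρ`.
    set l := |R| + 4 * (2 * n * r) with hl
    have hl0 : 0 ≤ l := by positivity
    let c : (Fin 2 → ℝ) × (Fin 2 → ℝ) :=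
      (fun i => l * (![e₀, e₁] i).im / n, fun i => l * (![e₀, e₁] i).re)
    have hc : ∀ i, datumPhasor n i c = (l : ℂ) * ![e₀, e₁] i := by
      intro i
      have hn0 : (n : ℝ) ≠ 0 := by positivity
      apply Complex.ext
      · simp [datumPhasor, c]
      · simp only [datumPhasor, c, Complex.im_ofReal_mul]
        field_simp
    have hself : ∀ e : ℂ, ‖e‖ = 1 → (conj e * ((l : ℂ) * e)).re = l := by
      intro e he
      rw [mul_left_comm, mul_comm (conj e), Complex.mul_conj, Complex.normSq_eq_norm_sq, he]
      simp
    refine ⟨c, fun d hd => ?_⟩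
    rw [Metric.mem_closedBall, dist_eq_norm] at hd
    have hdiff : ∀ i, ‖datumPhasor n i d - (l : ℂ) * ![e₀, e₁] i‖ ≤ 2 * n * r := by
      intro i
      rw [← hc]
      exact (norm_datumPhasor_sub_le n hn i d c).trans (by gcongr)
    have hre : ∀ e : ℂ, ‖e‖ = 1 → ∀ u : ℂ, ‖u - l * e‖ ≤ 2 * n * r →
        l - 2 * n * r ≤ (conj e * u).re := by
      intro e he u hu
      have h1 := re_conj_mul_le_norm (u := -(u - l * e)) he
      rw [norm_neg, neg_sub, mul_sub, Complex.sub_re, hself e he] at h1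
      linarith
    have h0 := hre e₀ he₀ _ (hdiff 0)
    have h1 := hre e₁ he₁ _ (hdiff 1)
    have hnr : 0 ≤ 2 * n * r := by positivity
    refine ⟨?_, ?_, ?_⟩
    · linarith [le_abs_self R]
    · linarith [le_abs_self R]
    · have h2 := norm_sub_norm_le (datumPhasor n 1 d) ((l : ℂ) * e₁)
      rw [norm_mul, he₁, mul_one, Complex.norm_real, Real.norm_eq_abs, abs_of_nonneg hl0] at h2
      have h3 : ‖datumPhasor n 1 d - (l : ℂ) * e₁‖ ≤ 2 * n * r := hdiff 1
      linarith [abs_nonneg R]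
  have hpos : 0 < volume (Metric.ball (0 : (Fin 2 → ℝ) × (Fin 2 → ℝ)) 1) :=
    Metric.measure_ball_pos _ _ one_pos
  have : (volume : Measure ((Fin 2 → ℝ) × (Fin 2 → ℝ))).IsAddHaarMeasure :=
    Measure.prod.instIsAddHaarMeasure _ _
  have hle : ∀ r : ℝ, 0 ≤ r → ENNReal.ofReal (r ^ 4) *
      volume (Metric.ball (0 : (Fin 2 → ℝ) × (Fin 2 → ℝ)) 1) ≤ volume (wedgeData n e₀ e₁ R) := by
    intro r hr
    obtain ⟨c, hc⟩ := hball r hr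
    refine le_trans (le_of_eq ?_) (measure_mono hc)
    rw [Measure.addHaar_closedBall volume c hr]
    simp
  have hlim : Tendsto (fun r : ℝ => ENNReal.ofReal (r ^ 4) *
      volume (Metric.ball (0 : (Fin 2 → ℝ) × (Fin 2 → ℝ)) 1)) atTop (𝓝 ⊤) := by
    have h1 : Tendsto (fun r : ℝ => ENNReal.ofReal (r ^ 4)) atTop (𝓝 ⊤) :=
      ENNReal.tendsto_ofReal_atTop.comp (tendsto_pow_atTop (by norm_num))
    have h2 := ENNReal.Tendsto.mul_const h1
      (b := volume (Metric.ball (0 : (Fin 2 → ℝ) × (Fin 2 → ℝ)) 1)) (Or.inl ENNReal.top_ne_zero)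
    rwa [ENNReal.top_mul hpos.ne'] at h2
  exact top_le_iff.1 (le_of_tendsto hlim ((eventually_ge_atTop 0).mono hle))

/-! ### Escape in the future and, by time reversal, in the past -/

theorem exists_escaping_set (n : ℕ) (hn : 1 ≤ n) (a b : Fin 2 → ℝ)
    (ha : ∀ i, a i = (n : ℝ) ^ 2) (hb : ∀ i, b i = (n : ℝ) ^ 2)
    (p : Fin 2 → ℝ → ℝ) (hp_cont : ∀ i, Continuous (p i))
    (hp_per : ∀ i, Function.Periodic (p i) (2 * π))
    (hp0 : pHat (p 0) n = 0)
    (φ : Fin 2 → ℝ → ℝ) (hφ : ∀ i, Continuous (φ i))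
    (hφ_bdd : ∀ i, ∃ M : ℝ, ∀ s, |φ i s| ≤ M)
    (φlim : Fin 2 → ℝ) (hφ_top : ∀ i, Tendsto (φ i) atTop (𝓝 (φlim i)))
    (hφ_bot : ∀ i, Tendsto (φ i) atBot (𝓝 (-φlim i)))
    (hφ0 : φlim 0 ≠ 0) (hφ1 : |φlim 1| < 3 / 16 * ‖pHat (p 1) n‖) :
    ∃ E : Set ((Fin 2 → ℝ) × (Fin 2 → ℝ)), MeasurableSet E ∧ volume E = ⊤ ∧
      ∀ x : Fin 2 → ℝ → ℝ, IsOscillatorSolution a b φ p x → initialDatum x ∈ E →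
        ∀ i, Tendsto (fun t => |x i t| ^ 2 + |deriv (x i) t| ^ 2) atTop atTop := by
  obtain ⟨e₀, e₁, R, δ, C, he₀, he₁, hδ, hx⟩ := exists_wedge_step n hn a b ha hb p hp_cont hp_per
    hp0 φ hφ hφ_bdd φlim hφ_top hφ_bot hφ0 hφ1
  refine ⟨wedgeData n e₀ e₁ R, measurableSet_wedgeData n e₀ e₁ R, volume_wedgeData n hn he₀ he₁ R,
    fun x hsol hmem i => tendsto_energy_of_phasor n hn ?_⟩
  -- Periodicity of the forcing lets the one-period estimate apply to each translate, with the same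
  -- constants.
  have hshift : ∀ k : ℕ, IsOscillatorSolution a b φ p (fun i t => x i (t + k * (2 * π))) :=
    fun k => hsol.comp_add_const fun i => (hp_per i).nat_mul k
  refine tendsto_phasor_of_wedge_step (R := R) (C := C) he₀ he₁ hδ (fun k i t ht => ?_)
    (fun k r hr h => ?_) hmem i
  · have := (hx _ (hshift k)).1 i t ht
    simpa only [phasor_comp_add_const, zero_add] using this
  · have := (hx _ (hshift k)).2 r hr
    simp only [phasor_comp_add_const, zero_add] at this
    exact this h

/-- Reversing time conjugates the coefficient, so its vanishing and its modulus are preserved. -/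
theorem pHat_comp_neg (p : ℝ → ℝ) (hp : Function.Periodic p (2 * π)) (n : ℕ) :
    pHat (fun t => p (-t)) n = conj (pHat p n) := by
  rw [conj_pHat]
  have hper : Function.Periodic (fun t => rotor n t * (p t : ℂ)) (2 * π) := fun t => by
    simp only [rotor_periodic n t, hp t]
  have h1 : ∀ t : ℝ, ((p (-t) : ℝ) : ℂ) * Complex.exp (Complex.I * n * t) =
      rotor n (-t) * (p (-t) : ℂ) := by
    intro t
    simp [rotor, mul_comm]
  simp only [pHat, h1]
  rw [intervalIntegral.integral_comp_neg (fun t => rotor n t * (p t : ℂ))]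
  have := hper.intervalIntegral_add_eq (-(2 * π)) 0
  simpa using this

theorem corollary4p7 (n : ℕ) (hn : 1 ≤ n) (a b : Fin 2 → ℝ)
    (ha : ∀ i, a i = (n : ℝ) ^ 2) (hb : ∀ i, b i = (n : ℝ) ^ 2)
    (p : Fin 2 → ℝ → ℝ) (hp_cont : ∀ i, Continuous (p i))
    (hp_per : ∀ i, Function.Periodic (p i) (2 * π))
    (hp0 : pHat (p 0) n = 0)
    (φ : Fin 2 → ℝ → ℝ) (hφ_lip : ∀ i, LocallyLipschitz (φ i))
    (hφ_bdd : ∀ i, ∃ M : ℝ, ∀ s, |φ i s| ≤ M)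
    (φlim : Fin 2 → ℝ) (hφ_top : ∀ i, Tendsto (φ i) atTop (𝓝 (φlim i)))
    (hφ_bot : ∀ i, Tendsto (φ i) atBot (𝓝 (-φlim i)))
    (hφ0 : φlim 0 ≠ 0) (hφ1 : |φlim 1| < 3 / 16 * ‖pHat (p 1) n‖) :
    ∃ Eplus Eminus : Set ((Fin 2 → ℝ) × (Fin 2 → ℝ)),
      MeasurableSet Eplus ∧ volume Eplus = ⊤ ∧
      MeasurableSet Eminus ∧ volume Eminus = ⊤ ∧
      (∀ x : Fin 2 → ℝ → ℝ, IsOscillatorSolution a b φ p x → initialDatum x ∈ Eplus →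
        ∀ i, Tendsto (fun t => |x i t| ^ 2 + |deriv (x i) t| ^ 2) atTop atTop) ∧
      (∀ x : Fin 2 → ℝ → ℝ, IsOscillatorSolution a b φ p x → initialDatum x ∈ Eminus →
        ∀ i, Tendsto (fun t => |x i t| ^ 2 + |deriv (x i) t| ^ 2) atBot atTop) := by
  have hφ := fun i => (hφ_lip i).continuous
  obtain ⟨E, hE, hEv, hEx⟩ := exists_escaping_set n hn a b ha hb p hp_cont hp_per hp0 φ hφ hφ_bdd
    φlim hφ_top hφ_bot hφ0 hφ1
  obtain ⟨F, hF, hFv, hFx⟩ := exists_escaping_set n hn a b ha hb (fun i t => p i (-t))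
    (fun i => (hp_cont i).comp continuous_neg)
    (fun i t => by
      have := (hp_per i).neg (-t)
      rwa [← neg_add] at this)
    (by rw [pHat_comp_neg _ (hp_per 0), hp0, map_zero]) φ hφ hφ_bdd φlim hφ_top hφ_bot hφ0
    (by rwa [pHat_comp_neg _ (hp_per 1), Complex.norm_conj])
  -- Time reversal acts on initial data by negating velocities, which preserves volume.
  have hmp : MeasurePreserving (fun d : (Fin 2 → ℝ) × (Fin 2 → ℝ) => (d.1, -d.2)) volume volume :=
    (MeasurePreserving.id (volume : Measure (Fin 2 → ℝ))).prod
      (Measure.measurePreserving_neg (volume : Measure (Fin 2 → ℝ)))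
  refine ⟨E, (fun d => (d.1, -d.2)) ⁻¹' F, hE, hEv, hmp.measurable hF, ?_, hEx,
    fun x hx hmem i => ?_⟩
  · rw [hmp.measure_preimage hF.nullMeasurableSet, hFv]
  · have hd : deriv (fun t => x i (-t)) = fun t => -deriv (x i) (-t) := by
      funext t; exact deriv_comp_neg (x i) t
    have h0 : initialDatum (fun i t => x i (-t)) ∈ F := by
      convert (Set.mem_preimage.1 hmem) using 1
      simp only [initialDatum, neg_zero, deriv_comp_neg]
      rfl
    have h1 := (hFx _ hx.comp_neg h0 i).comp tendsto_neg_atBot_atTop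
    simpa only [Function.comp_def, hd, neg_neg, abs_neg] using h1
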